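/- Let $\mathbb C[[X_0,X_1,\dots]]$ be the algebra of all formal power series in countably many commuting indeterminates, with monomials $X^r$, where $r$ runs through the finitely supported sequences of non-negative integers and $|r|=\sum_i r_i$. Let $$\mathcal U=\Big\{f=\sum_r\alpha_rX^r\;:\;q_m(f):=\sum_r|\alpha_r|\,m^{|r|}<\infty\ \text{ for all } m=1,2,\dots\Big\},$$ a subalgebra of $\mathbb C[[X_0,X_1,\dots]]$, with the topology defined by the norms $(q_m)_{m\ge1}$, and let $\mathcal U^{(1)}=\{f\in\mathcal U:\alpha_r=0\text{ whenever }|r|\ne1\}$ be its subspace of $1$-homogeneous series $\sum_i\alpha_iX_i$, with the subspace topology. Give $\mathbb C[[X]]$ the topology of coordinatewise convergence. (i) For every continuous linear map $\beta:\mathcal U^{(1)}\to\mathbb C[[X]]$ there is a continuous unital algebra homomorphism $\bar\beta:\mathcal U\to\mathbb C[[X]]$ with $\bar\beta|_{\mathcal U^{(1)}}=\beta$. (ii) $\mathcal U$ is isometrically isomorphic to a Fréchet algebra of power series. That is, there are a subalgebra $A\subset\mathbb C[[X]]$ containing $X$, a complete Hausdorff topology $\tau$ on $A$ defined by an increasing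 sequence $(p_m)_{m\ge1}$ of submultiplicative seminorms such that the inclusion $(A,\tau)\hookrightarrow\mathbb C[[X]]$ is continuous, and an algebra isomorphism $\Phi:\mathcal U\to A$ that is a homeomorphism and satisfies $p_m(\Phi(f))=q_m(f)$ for all $f\in\mathcal U$ and $m\ge1$. -/

import Mathlib

open scoped PowerSeries PowerSeries.WithPiTopology Topology

/-- For a formal power series `f = ∑ α_r X^r` in countably many commuting indeterminates
`X_0, X_1, …`, the family of terms `|α_r| m^|r|`, indexed by the exponents `r : ℕ →₀ ℕ`
of total degree `|r|`. -/
noncomputable def weightedTerm (m : ℕ) (f : MvPowerSeries ℕ ℂ) (r : ℕ →₀ ℕ) : ℝ :=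
  ‖MvPowerSeries.coeff r f‖ * (m : ℝ) ^ r.degree

theorem weightedTerm_nonneg (m : ℕ) (f : MvPowerSeries ℕ ℂ) (r : ℕ →₀ ℕ) :
    0 ≤ weightedTerm m f r := by
  unfold weightedTerm; positivity

theorem weightedTerm_add_le (m : ℕ) (f g : MvPowerSeries ℕ ℂ) (r : ℕ →₀ ℕ) :
    weightedTerm m (f + g) r ≤ weightedTerm m f r + weightedTerm m g r := by
  unfold weightedTerm
  rw [map_add, ← add_mul]
  gcongr
  exact norm_add_le _ _

theorem weightedTerm_smul (m : ℕ) (c : ℂ) (f : MvPowerSeries ℕ ℂ) (r : ℕ →₀ ℕ) :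
    weightedTerm m (c • f) r = ‖c‖ * weightedTerm m f r := by
  simp [weightedTerm, mul_assoc]

theorem weightedTerm_mul_le (m : ℕ) (f g : MvPowerSeries ℕ ℂ) (r : ℕ →₀ ℕ) :
    weightedTerm m (f * g) r ≤
      ∑ p ∈ Finset.HasAntidiagonal.antidiagonal r, weightedTerm m f p.1 * weightedTerm m g p.2 := by
  unfold weightedTerm
  rw [MvPowerSeries.coeff_mul]
  refine (mul_le_mul_of_nonneg_right (norm_sum_le _ _) (by positivity)).trans ?_
  rw [Finset.sum_mul]
  refine Finset.sum_le_sum fun p hp => le_of_eq ?_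
  rw [← Finset.HasAntidiagonal.mem_antidiagonal.1 hp, map_add, pow_add, norm_mul]
  ring

theorem summable_weightedTerm_mul {m : ℕ} {f g : MvPowerSeries ℕ ℂ}
    (hf : Summable (weightedTerm m f)) (hg : Summable (weightedTerm m g)) :
    Summable (weightedTerm m (f * g)) :=
  Summable.of_nonneg_of_le (weightedTerm_nonneg m _) (weightedTerm_mul_le m f g)
    (summable_sum_mul_antidiagonal_of_summable_mul
      (hf.mul_of_nonneg hg (weightedTerm_nonneg m f) (weightedTerm_nonneg m g)))

theorem summable_weightedTerm_algebraMap (m : ℕ) (c : ℂ) :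
    Summable (weightedTerm m (algebraMap ℂ (MvPowerSeries ℕ ℂ) c)) := by
  classical
  refine summable_of_ne_finset_zero (s := {0}) fun r hr => ?_
  have hr' : r ≠ 0 := by simpa using hr
  simp [weightedTerm, MvPowerSeries.algebraMap_apply, MvPowerSeries.coeff_C, hr']

/-- The formal power series `∑ α_r X^r` in countably many commuting indeterminates with
`∑ |α_r| m^|r| < ∞` for every integer `m ≥ 1`, as a subalgebra of `ℂ[[X_0, X_1, …]]`. -/
noncomputable def testSubalgebra : Subalgebra ℂ (MvPowerSeries ℕ ℂ) where
  carrier := {f | ∀ m : ℕ, 1 ≤ m → Summable (weightedTerm m f)}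
  mul_mem' hf hg m hm := summable_weightedTerm_mul (hf m hm) (hg m hm)
  add_mem' hf hg m hm := Summable.of_nonneg_of_le (weightedTerm_nonneg m _)
    (weightedTerm_add_le m _ _) ((hf m hm).add (hg m hm))
  algebraMap_mem' c m _ := summable_weightedTerm_algebraMap m c

/-- The test algebra `𝒰`. -/
def TestAlgebra : Type := testSubalgebra

namespace TestAlgebra

noncomputable instance : CommRing TestAlgebra := inferInstanceAs (CommRing testSubalgebra)

noncomputable instance : Algebra ℂ TestAlgebra := inferInstanceAs (Algebra ℂ testSubalgebra)

/-- The inclusion of `𝒰` in `ℂ[[X_0, X_1, …]]`. -/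
noncomputable def toMvPowerSeries : TestAlgebra →ₐ[ℂ] MvPowerSeries ℕ ℂ := testSubalgebra.val

theorem summable (f : TestAlgebra) (m : ℕ) :
    Summable (weightedTerm (m + 1) (toMvPowerSeries f)) :=
  f.2 (m + 1) (Nat.le_add_left 1 m)

/-- The defining norms `∑ α_r X^r ↦ ∑ |α_r| m^|r|`, `m = 1, 2, …`, of `𝒰`; the one with
weight `m + 1` has index `m`. -/
noncomputable def q : SeminormFamily ℂ TestAlgebra ℕ := fun m =>
  Seminorm.of (fun f => ∑' r, weightedTerm (m + 1) (toMvPowerSeries f) r)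
    (fun f g => by
      rw [← (summable f m).tsum_add (summable g m)]
      refine (summable (f + g) m).tsum_le_tsum (fun r => ?_) ((summable f m).add (summable g m))
      rw [map_add]
      exact weightedTerm_add_le _ _ _ r)
    (fun c f => by
      rw [← tsum_mul_left]
      refine tsum_congr fun r => ?_
      rw [map_smul, weightedTerm_smul])

/-- The usual topology of `𝒰`, defined by the norms `q`. -/
noncomputable instance : TopologicalSpace TestAlgebra := q.moduleFilterBasis.topology

/-- The subspace `𝒰^(1)` of the 1-homogeneous series `∑ α_i X_i` in `𝒰`; it carries the
subspace topology. -/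
noncomputable def degreeOne : Submodule ℂ TestAlgebra where
  carrier := {f | ∀ r : ℕ →₀ ℕ, r.degree ≠ 1 → MvPowerSeries.coeff r (toMvPowerSeries f) = 0}
  add_mem' hf hg r hr := by rw [map_add, map_add, hf r hr, hg r hr, add_zero]
  zero_mem' r _ := by rw [map_zero, map_zero]
  smul_mem' c f hf r hr := by rw [map_smul, map_smul, hf r hr, smul_zero]

end TestAlgebra

/-- The topology `τ` makes the complex algebra `A` a Fréchet algebra, with `p` as an increasing
defining sequence of submultiplicative seminorms: the topology is that of `p`, it is Hausdorff
(hence metrizable, `p` being countable), and it is complete (for a metrizable topology it is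
enough to consider Cauchy sequences). -/
structure IsFrechetAlgebra (A : Type*) [Ring A] [Algebra ℂ A] (τ : TopologicalSpace A)
    (p : SeminormFamily ℂ A ℕ) : Prop where
  monotone : Monotone p
  submultiplicative : ∀ (m : ℕ) (a b : A), p m (a * b) ≤ p m a * p m b
  withSeminorms : WithSeminorms p
  separated : ∀ a : A, (∀ m, p m a = 0) → a = 0
  complete : ∀ u : ℕ → A,
    (∀ (m : ℕ) (ε : ℝ), 0 < ε → ∃ N, ∀ i ≥ N, ∀ j ≥ N, p m (u i - u j) < ε) →
      ∃ a : A, Filter.Tendsto u Filter.atTop (𝓝 a)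

/-- A Fréchet algebra of power series: a subalgebra `A` of `ℂ[[X]]` that contains the
indeterminate, with a Fréchet algebra topology `τ` (and a defining sequence `p` for it) for which
the inclusion in `ℂ[[X]]` is continuous. Here `ℂ[[X]]` has the topology of coordinatewise
convergence. -/
structure IsFrechetAlgebraOfPowerSeries (A : Subalgebra ℂ ℂ⟦X⟧) (τ : TopologicalSpace A)
    (p : SeminormFamily ℂ A ℕ) : Prop where
  X_mem : (PowerSeries.X : ℂ⟦X⟧) ∈ A
  isFrechetAlgebra : IsFrechetAlgebra A τ p
  continuous_inclusion : Continuous[τ, PowerSeries.WithPiTopology.instTopologicalSpace ℂ] (A.val : A → ℂ⟦X⟧)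

/-! Both parts rest on substituting power series `b_i` for `X_i`. If the coefficients of the `b_i`
are bounded uniformly in `i` in each degree (`CoeffBounded`), then the degree-`n` coefficient of `b
^ r` is at most `M ^ |r|` with `M` depending only on `n`. Hence `f ↦ f(b)` is a well-defined
continuous homomorphism (`substAlgHom`). For (i), take `b_i = β(X_i)`: the `X_i` are bounded for
every norm, so continuity of `β` gives `CoeffBounded`.

For (ii), it suffices to find `b` with `b_0 = X` and `f ↦ f(b)` injective, since the norms can then
be transported to the image. Take `b_j = ∑ c_K X ^ (2 ^ K)` over the `K` with index `j`, with `c_K`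
growing very fast. Modulo `X ^ (2 ^ (K + 1))` the newest term `c_K X ^ (2 ^ K)` has square zero, so
it enters `f(b)` only through `c_K X ^ (2 ^ K) (∂_i f)(b)`, where `i` is the index of `K`. The other
contribution comes from earlier terms and is dominated by `c_K`. Thus `f(b) = 0` forces `(∂_i f)(b)
= 0` for each `i ≥ 1`, because such `i` is the index of infinitely many `K`. The chain rule, with
`b_0 = X`, then gives `(∂_0 f)(b) = 0`. So the kernel is stable under all partial derivatives. Its
elements have zero constant term, as no `b_j` has a constant term, and therefore all their
coefficients vanish (`eq_zero_of_subst_lacunarySeries_eq_zero`). -/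

/-! ### Monomials evaluated at a sequence of ring elements -/

section MonomialEval

variable {R : Type*} [CommRing R]

/-- The value `∏ b_i ^ r_i` of the monomial with exponent `r` at the sequence `b`. -/
noncomputable def monomialEval (b : ℕ → R) (r : ℕ →₀ ℕ) : R := r.prod fun i k => b i ^ k

@[simp]
theorem monomialEval_zero (b : ℕ → R) : monomialEval b 0 = 1 := by simp [monomialEval]

theorem monomialEval_add (b : ℕ → R) (r s : ℕ →₀ ℕ) :
    monomialEval b (r + s) = monomialEval b r * monomialEval b s :=
  Finsupp.prod_add_index' (by simp) (fun _ _ _ => pow_add _ _ _)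

@[simp]
theorem monomialEval_single_one (b : ℕ → R) (i : ℕ) :
    monomialEval b (Finsupp.single i 1) = b i := by
  simp [monomialEval]

theorem Finsupp.induction_add_single_one {P : (ℕ →₀ ℕ) → Prop} (zero : P 0)
    (add : ∀ r i, P r → P (r + Finsupp.single i 1)) (r : ℕ →₀ ℕ) : P r := by
  induction h : r.degree generalizing r with
  | zero => rwa [(Finsupp.degree_eq_zero_iff r).1 h]
  | succ n ih =>
    obtain ⟨i, hi⟩ : ∃ i, r i ≠ 0 := by
      by_contra! h0
      obtain rfl : r = 0 := Finsupp.ext h0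
      simp at h
    have hle : Finsupp.single i 1 ≤ r := by
      simpa [Finsupp.single_le_iff] using Nat.one_le_iff_ne_zero.2 hi
    obtain ⟨t, rfl⟩ := exists_add_of_le hle
    rw [map_add, Finsupp.degree_single] at h
    rw [add_comm]
    exact add t i (ih t (by omega))

theorem map_monomialEval {S : Type*} [CommRing S] (φ : R →+* S) (b : ℕ → R) (r : ℕ →₀ ℕ) :
    φ (monomialEval b r) = monomialEval (fun i => φ (b i)) r := by
  simp [monomialEval, Finsupp.prod, map_prod]

/-- The product rule for `∂_i (X ^ r * X_j)`, evaluated at `b`. Truncated subtraction of exponents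
is harmless: where it truncates, the factor `r i` is zero. -/
theorem monomialEval_deriv_add_single (b : ℕ → R) (r : ℕ →₀ ℕ) (i j : ℕ) :
    (((r + Finsupp.single j 1 : ℕ →₀ ℕ) i : ℕ) : R) *
        monomialEval b (r + Finsupp.single j 1 - Finsupp.single i 1) =
      (r i : R) * monomialEval b (r - Finsupp.single i 1) * b j +
        if j = i then monomialEval b r else 0 := by
  by_cases hr : r i = 0
  · by_cases hij : j = i
    · subst hij
      simp [hr]
    · simp [hr, hij]
  · have hle : Finsupp.single i 1 ≤ r := by
      simpa [Finsupp.single_le_iff] using Nat.one_le_iff_ne_zero.2 hr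
    obtain ⟨t, rfl⟩ := exists_add_of_le hle
    have h1 : Finsupp.single i 1 + t + Finsupp.single j 1 - Finsupp.single i 1
        = t + Finsupp.single j 1 := by
      rw [add_assoc, add_tsub_cancel_left]
    rw [h1, add_tsub_cancel_left, monomialEval_add, monomialEval_add, monomialEval_single_one,
      monomialEval_single_one]
    by_cases hij : j = i
    · subst hij
      simp
      ring
    · simp [hij]
      ring

/-- The first-order Taylor expansion in the variable `i`, exact because `x ^ 2 = 0`. -/
theorem monomialEval_add_of_sq_eq_zero (b : ℕ → R) {x : R} (hx : x ^ 2 = 0) (i : ℕ) (r : ℕ →₀ ℕ) :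
    monomialEval (fun j => b j + if j = i then x else 0) r =
      monomialEval b r + (r i : R) * monomialEval b (r - Finsupp.single i 1) * x := by
  induction r using Finsupp.induction_add_single_one with
  | zero => simp
  | add r j ih =>
    rw [monomialEval_deriv_add_single, monomialEval_add, ih, monomialEval_add,
      monomialEval_single_one, monomialEval_single_one]
    split_ifs with h
    · linear_combination (r i : R) * monomialEval b (r - Finsupp.single i 1) * hx
    · ring

theorem Derivation.monomialEval_apply {A : Type*} [CommRing A] [Algebra A R]
    (D : Derivation A R R) (b : ℕ → R) {s : Finset ℕ} (r : ℕ →₀ ℕ) (hs : r.support ⊆ s) :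
    D (monomialEval b r) =
      ∑ i ∈ s, (r i : R) * monomialEval b (r - Finsupp.single i 1) * D (b i) := by
  induction r using Finsupp.induction_add_single_one with
  | zero => simp
  | add r j ih =>
    have hr : r.support ⊆ s := by
      refine (Finsupp.support_mono ?_).trans hs
      exact le_self_add
    have hj : j ∈ s := hs (by simp)
    simp_rw [monomialEval_deriv_add_single, add_mul, Finset.sum_add_distrib, ite_mul, zero_mul]
    rw [Finset.sum_ite_eq, if_pos hj, monomialEval_add, monomialEval_single_one, D.leibniz, ih hr,
      smul_eq_mul, smul_eq_mul, Finset.mul_sum, add_comm]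
    congr 1
    exact Finset.sum_congr rfl fun i _ => by ring

end MonomialEval

/-! ### Weighted norms of truncated power series -/

/-- The weighted norm `∑_{k ≤ n} |c_k| ρ ^ k` of the truncation at degree `n` of the power series
`∑ c_k X ^ k`. -/
noncomputable def truncNorm (ρ : ℝ) (n : ℕ) (f : ℂ⟦X⟧) : ℝ :=
  ∑ k ∈ Finset.range (n + 1), ‖PowerSeries.coeff k f‖ * ρ ^ k

theorem truncNorm_nonneg {ρ : ℝ} (hρ : 0 ≤ ρ) (n : ℕ) (f : ℂ⟦X⟧) : 0 ≤ truncNorm ρ n f :=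
  Finset.sum_nonneg fun _ _ => by positivity

theorem truncNorm_one (ρ : ℝ) (n : ℕ) : truncNorm ρ n 1 = 1 := by
  unfold truncNorm
  rw [Finset.sum_range_succ']
  simp [PowerSeries.coeff_one]

/-- The pairs of degrees with sum at most `n` form part of the square `[0, n] × [0, n]` that the
product of the two norms runs over. -/
theorem truncNorm_mul_le {ρ : ℝ} (hρ : 0 ≤ ρ) (n : ℕ) (f g : ℂ⟦X⟧) :
    truncNorm ρ n (f * g) ≤ truncNorm ρ n f * truncNorm ρ n g := by
  unfold truncNorm
  rw [Finset.sum_mul_sum, ← Finset.sum_product']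
  calc ∑ k ∈ Finset.range (n + 1), ‖PowerSeries.coeff k (f * g)‖ * ρ ^ k
      ≤ ∑ k ∈ Finset.range (n + 1), ∑ p ∈ Finset.HasAntidiagonal.antidiagonal k,
          ‖PowerSeries.coeff p.1 f‖ * ρ ^ p.1 * (‖PowerSeries.coeff p.2 g‖ * ρ ^ p.2) := by
        refine Finset.sum_le_sum fun k _ => ?_
        rw [PowerSeries.coeff_mul]
        refine (mul_le_mul_of_nonneg_right (norm_sum_le _ _) (by positivity)).trans ?_
        rw [Finset.sum_mul]
        refine Finset.sum_le_sum fun p hp => le_of_eq ?_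
        rw [← Finset.HasAntidiagonal.mem_antidiagonal.1 hp, pow_add, norm_mul]
        ring
    _ = ∑ x ∈ (Finset.range (n + 1)).sigma fun k => Finset.HasAntidiagonal.antidiagonal k,
          ‖PowerSeries.coeff x.2.1 f‖ * ρ ^ x.2.1 * (‖PowerSeries.coeff x.2.2 g‖ * ρ ^ x.2.2) := by
        rw [Finset.sum_sigma]
    _ = ∑ p ∈ ((Finset.range (n + 1)).sigma fun k =>
            Finset.HasAntidiagonal.antidiagonal k).image Sigma.snd,
          ‖PowerSeries.coeff p.1 f‖ * ρ ^ p.1 * (‖PowerSeries.coeff p.2 g‖ * ρ ^ p.2) := by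
        rw [Finset.sum_image]
        rintro ⟨k, p⟩ hk ⟨l, q⟩ hl (rfl : p = q)
        simp only [Finset.coe_sigma, Set.mem_sigma_iff, Finset.mem_coe,
          Finset.HasAntidiagonal.mem_antidiagonal] at hk hl
        obtain rfl : k = l := hk.2.symm.trans hl.2
        rfl
    _ ≤ _ := by
        refine Finset.sum_le_sum_of_subset_of_nonneg ?_ fun _ _ _ => by positivity
        intro p hp
        simp only [Finset.mem_image, Finset.mem_sigma, Finset.mem_range,
          Finset.HasAntidiagonal.mem_antidiagonal] at hp
        obtain ⟨⟨k, q⟩, ⟨h1, h2⟩, rfl⟩ := hp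
        simp only [Finset.mem_product, Finset.mem_range] at h1 h2 ⊢
        omega

theorem norm_coeff_mul_pow_le_truncNorm {ρ : ℝ} (hρ : 0 ≤ ρ) (n : ℕ) (f : ℂ⟦X⟧) :
    ‖PowerSeries.coeff n f‖ * ρ ^ n ≤ truncNorm ρ n f :=
  Finset.single_le_sum (f := fun k => ‖PowerSeries.coeff k f‖ * ρ ^ k)
    (fun _ _ => by positivity) (Finset.self_mem_range_succ n)

theorem truncNorm_monomialEval_le {ρ C : ℝ} (hρ : 0 ≤ ρ) {n : ℕ} {b : ℕ → ℂ⟦X⟧}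
    (hb : ∀ i, truncNorm ρ n (b i) ≤ C) (r : ℕ →₀ ℕ) :
    truncNorm ρ n (monomialEval b r) ≤ C ^ r.degree := by
  have hC : 0 ≤ C := (truncNorm_nonneg hρ n (b 0)).trans (hb 0)
  induction r using Finsupp.induction_add_single_one with
  | zero => simp [truncNorm_one]
  | add r i ih =>
    rw [monomialEval_add, monomialEval_single_one, map_add, pow_add, Finsupp.degree_single, pow_one]
    exact (truncNorm_mul_le hρ n _ _).trans
      (mul_le_mul ih (hb i) (truncNorm_nonneg hρ n _) (by positivity))

/-- The coefficients of the power series `b_i` in each degree are bounded uniformly in `i`. -/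
def CoeffBounded (b : ℕ → ℂ⟦X⟧) : Prop := ∀ n, ∃ C : ℝ, ∀ i, ‖PowerSeries.coeff n (b i)‖ ≤ C

/-- With `ρ = 1`, submultiplicativity of `truncNorm` makes the bound exponential in `r.degree`, the
growth that a single norm `q m` absorbs. -/
theorem CoeffBounded.norm_coeff_monomialEval_le {b : ℕ → ℂ⟦X⟧} (hb : CoeffBounded b) (n : ℕ) :
    ∃ m : ℕ, ∀ r, ‖PowerSeries.coeff n (monomialEval b r)‖ ≤ ((m + 1 : ℕ) : ℝ) ^ r.degree := by
  choose C hC using hb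
  obtain ⟨m, hm⟩ := exists_nat_ge (∑ k ∈ Finset.range (n + 1), C k)
  refine ⟨m, fun r => ?_⟩
  have h := truncNorm_monomialEval_le (ρ := 1) (C := ((m + 1 : ℕ) : ℝ)) zero_le_one (n := n)
    (b := b) (fun i => ?_) r
  · simpa using (norm_coeff_mul_pow_le_truncNorm (ρ := 1) zero_le_one n (monomialEval b r)).trans h
  · refine (Finset.sum_le_sum fun k _ => ?_).trans (hm.trans (by simp))
    simpa using hC k i

/-! ### The seminorms of the test algebra -/

namespace TestAlgebra

theorem toMvPowerSeries_injective : Function.Injective toMvPowerSeries := Subtype.val_injective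

/-- The coefficient of `X ^ r`. -/
noncomputable def coeff (r : ℕ →₀ ℕ) (f : TestAlgebra) : ℂ :=
  MvPowerSeries.coeff r (toMvPowerSeries f)

@[ext]
theorem ext {f g : TestAlgebra} (h : ∀ r, coeff r f = coeff r g) : f = g :=
  toMvPowerSeries_injective (MvPowerSeries.ext h)

theorem coeff_add (r : ℕ →₀ ℕ) (f g : TestAlgebra) : coeff r (f + g) = coeff r f + coeff r g := by
  simp [coeff]

theorem coeff_sub (r : ℕ →₀ ℕ) (f g : TestAlgebra) : coeff r (f - g) = coeff r f - coeff r g := by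
  simp [coeff]

theorem coeff_smul (r : ℕ →₀ ℕ) (c : ℂ) (f : TestAlgebra) : coeff r (c • f) = c * coeff r f := by
  simp [coeff]

theorem coeff_sum {ι : Type*} (r : ℕ →₀ ℕ) (s : Finset ι) (f : ι → TestAlgebra) :
    coeff r (∑ i ∈ s, f i) = ∑ i ∈ s, coeff r (f i) := by
  simp [coeff]

theorem coeff_mul (r : ℕ →₀ ℕ) (f g : TestAlgebra) : coeff r (f * g) =
    ∑ p ∈ Finset.HasAntidiagonal.antidiagonal r, coeff p.1 f * coeff p.2 g := by
  classical
  simp [coeff, MvPowerSeries.coeff_mul]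

theorem summable_norm_coeff (m : ℕ) (f : TestAlgebra) :
    Summable fun r : ℕ →₀ ℕ => ‖coeff r f‖ * ((m + 1 : ℕ) : ℝ) ^ r.degree :=
  summable f m

theorem q_apply (m : ℕ) (f : TestAlgebra) :
    q m f = ∑' r : ℕ →₀ ℕ, ‖coeff r f‖ * ((m + 1 : ℕ) : ℝ) ^ r.degree := rfl

theorem withSeminorms_q : WithSeminorms q := ⟨rfl⟩

/-- The element of the test algebra with given coefficients. -/
noncomputable def mk (a : (ℕ →₀ ℕ) → ℂ)
    (ha : ∀ m : ℕ, Summable fun r : ℕ →₀ ℕ => ‖a r‖ * ((m + 1 : ℕ) : ℝ) ^ r.degree) :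
    TestAlgebra :=
  (⟨a, fun m hm => by
    obtain ⟨k, rfl⟩ := Nat.exists_eq_add_of_le' hm
    exact ha k⟩ : testSubalgebra)

@[simp]
theorem coeff_mk (a : (ℕ →₀ ℕ) → ℂ) (ha) (r : ℕ →₀ ℕ) : coeff r (mk a ha) = a r := rfl

theorem norm_coeff_mul_le_q (m : ℕ) (f : TestAlgebra) (r : ℕ →₀ ℕ) :
    ‖coeff r f‖ * ((m + 1 : ℕ) : ℝ) ^ r.degree ≤ q m f :=
  (summable_norm_coeff m f).le_tsum r fun _ _ => by positivity

theorem norm_coeff_le_q (m : ℕ) (f : TestAlgebra) (r : ℕ →₀ ℕ) : ‖coeff r f‖ ≤ q m f := by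
  refine le_trans ?_ (norm_coeff_mul_le_q m f r)
  refine le_mul_of_one_le_right (norm_nonneg _) (one_le_pow₀ ?_)
  simp

theorem q_monotone : Monotone q := fun m n h f => by
  rw [q_apply, q_apply]
  refine (summable_norm_coeff m f).tsum_le_tsum (fun r => ?_) (summable_norm_coeff n f)
  gcongr

theorem norm_coeff_mul_le (m : ℕ) (f g : TestAlgebra) (r : ℕ →₀ ℕ) :
    ‖coeff r (f * g)‖ * ((m + 1 : ℕ) : ℝ) ^ r.degree ≤
      ∑ p ∈ Finset.HasAntidiagonal.antidiagonal r,
        ‖coeff p.1 f‖ * ((m + 1 : ℕ) : ℝ) ^ p.1.degree *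
          (‖coeff p.2 g‖ * ((m + 1 : ℕ) : ℝ) ^ p.2.degree) := by
  have h := weightedTerm_mul_le (m + 1) (toMvPowerSeries f) (toMvPowerSeries g) r
  rw [← map_mul] at h
  exact h

theorem q_mul_le (m : ℕ) (f g : TestAlgebra) : q m (f * g) ≤ q m f * q m g := by
  have hf := summable_norm_coeff m f
  have hg := summable_norm_coeff m g
  have hfg := hf.mul_of_nonneg hg (fun r => mul_nonneg (norm_nonneg _) (by positivity))
    (fun r => mul_nonneg (norm_nonneg _) (by positivity))
  have h := hf.tsum_mul_tsum_eq_tsum_sum_antidiagonal hg hfg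
  rw [← q_apply, ← q_apply] at h
  rw [h, q_apply m (f * g)]
  exact (summable_norm_coeff m (f * g)).tsum_le_tsum (norm_coeff_mul_le m f g)
    (summable_sum_mul_antidiagonal_of_summable_mul
      (f := fun r : ℕ →₀ ℕ => ‖coeff r f‖ * ((m + 1 : ℕ) : ℝ) ^ r.degree)
      (g := fun r : ℕ →₀ ℕ => ‖coeff r g‖ * ((m + 1 : ℕ) : ℝ) ^ r.degree) hfg)

theorem eq_zero_of_q_eq_zero {m : ℕ} {f : TestAlgebra} (h : q m f = 0) : f = 0 := by
  ext r
  have := norm_coeff_le_q m f r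
  rw [h, norm_le_zero_iff] at this
  simpa [coeff] using this

theorem q_le_of_sum_le {m : ℕ} {f : TestAlgebra} {C : ℝ}
    (h : ∀ s : Finset (ℕ →₀ ℕ), ∑ r ∈ s, ‖coeff r f‖ * ((m + 1 : ℕ) : ℝ) ^ r.degree ≤ C) :
    q m f ≤ C :=
  (summable_norm_coeff m f).tsum_le_of_sum_le h

theorem exists_tendsto_of_cauchy (u : ℕ → TestAlgebra)
    (hu : ∀ (m : ℕ) (ε : ℝ), 0 < ε → ∃ N, ∀ i ≥ N, ∀ j ≥ N, q m (u i - u j) < ε) :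
    ∃ f : TestAlgebra, Filter.Tendsto u Filter.atTop (𝓝 f) := by
  have hc (r : ℕ →₀ ℕ) : ∃ a : ℂ, Filter.Tendsto (fun i => coeff r (u i)) Filter.atTop (𝓝 a) := by
    refine cauchySeq_tendsto_of_complete (Metric.cauchySeq_iff.2 fun ε hε => ?_)
    obtain ⟨N, hN⟩ := hu 0 ε hε
    refine ⟨N, fun i hi j hj => ?_⟩
    rw [dist_eq_norm, ← coeff_sub]
    exact (norm_coeff_le_q 0 _ r).trans_lt (hN i hi j hj)
  choose a ha using hc
  -- Bounds over finite sets pass to the coefficientwise limit before summability of `a` is known;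
  -- that summability is then deduced from them.
  have key (m : ℕ) (ε : ℝ) (hε : 0 < ε) : ∃ N, ∀ i ≥ N, ∀ s : Finset (ℕ →₀ ℕ),
      ∑ r ∈ s, ‖coeff r (u i) - a r‖ * ((m + 1 : ℕ) : ℝ) ^ r.degree ≤ ε := by
    obtain ⟨N, hN⟩ := hu m ε hε
    refine ⟨N, fun i hi s => ?_⟩
    refine le_of_tendsto (x := Filter.atTop)
      (f := fun j => ∑ r ∈ s, ‖coeff r (u i) - coeff r (u j)‖ * ((m + 1 : ℕ) : ℝ) ^ r.degree)
      (tendsto_finsetSum _ fun r _ => ((ha r).const_sub _).norm.mul_const _) ?_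
    filter_upwards [Filter.eventually_ge_atTop N] with j hj
    simp_rw [← coeff_sub]
    exact ((summable_norm_coeff m (u i - u j)).sum_le_tsum s fun _ _ => by positivity).trans
      (hN i hi j hj).le
  have hsum (m : ℕ) : Summable fun r : ℕ →₀ ℕ => ‖a r‖ * ((m + 1 : ℕ) : ℝ) ^ r.degree := by
    obtain ⟨N, hN⟩ := key m 1 one_pos
    have h1 : Summable fun r : ℕ →₀ ℕ =>
        ‖coeff r (u N) - a r‖ * ((m + 1 : ℕ) : ℝ) ^ r.degree :=
      summable_of_sum_le (fun _ => by positivity) (hN N le_rfl)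
    refine Summable.of_nonneg_of_le (fun _ => by positivity) (fun r => ?_)
      ((summable_norm_coeff m (u N)).add h1)
    rw [← add_mul]
    gcongr
    calc ‖a r‖ = ‖coeff r (u N) - (coeff r (u N) - a r)‖ := by rw [sub_sub_cancel]
      _ ≤ _ := norm_sub_le _ _
  refine ⟨mk a hsum, (withSeminorms_q.tendsto_nhds_atTop _ _).2 fun m ε hε => ?_⟩
  obtain ⟨N, hN⟩ := key m (ε / 2) (half_pos hε)
  refine ⟨N, fun i hi => (q_le_of_sum_le fun s => ?_).trans_lt (half_lt_self hε)⟩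
  simp_rw [coeff_sub, coeff_mk]
  exact hN i hi s

/-! ### Monomial expansion and partial derivatives -/

/-- The term `α_r X ^ r` of a series. -/
noncomputable def term (f : TestAlgebra) (r : ℕ →₀ ℕ) : TestAlgebra :=
  mk (fun s => if s = r then coeff r f else 0) fun m =>
    summable_of_ne_finset_zero (s := {r}) fun s hs => by
      have hs' : s ≠ r := by simpa using hs
      simp [hs']

@[simp]
theorem coeff_term (f : TestAlgebra) (r s : ℕ →₀ ℕ) :
    coeff s (term f r) = if s = r then coeff r f else 0 := rfl

theorem hasSum_term (f : TestAlgebra) : HasSum (term f) f := by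
  refine (withSeminorms_q.tendsto_nhds _ _).2 fun m ε hε => ?_
  have hS := (summable_norm_coeff m f).hasSum
  filter_upwards [hS.eventually (lt_mem_nhds (sub_lt_self _ hε))] with s hs
  classical
  -- The partial sum and the remainder have disjoint supports, so their norms add exactly.
  have h : q m (∑ r ∈ s, term f r - f) + q m (∑ r ∈ s, term f r) = q m f := by
    rw [q_apply, q_apply, q_apply,
      ← (summable_norm_coeff m _).tsum_add (summable_norm_coeff m _)]
    refine tsum_congr fun r => ?_
    rw [coeff_sub, coeff_sum]
    simp only [coeff_term, Finset.sum_ite_eq]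
    split_ifs <;> simp
  have h2 : ∑ r ∈ s, ‖coeff r f‖ * ((m + 1 : ℕ) : ℝ) ^ r.degree ≤ q m (∑ r ∈ s, term f r) := by
    rw [q_apply]
    refine le_trans (Finset.sum_le_sum fun r hr => ?_)
      ((summable_norm_coeff m _).sum_le_tsum s fun _ _ => by positivity)
    rw [coeff_sum]
    simp [hr]
  rw [q_apply m f] at h
  linarith

/-- The partial derivative with respect to `X_i`. -/
noncomputable def pderiv (i : ℕ) (f : TestAlgebra) : TestAlgebra :=
  mk (fun r => (r i + 1) * coeff (r + Finsupp.single i 1) f) fun m => by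
    have hinj : Function.Injective fun r : ℕ →₀ ℕ => r + Finsupp.single i 1 :=
      add_left_injective _
    -- The factor `r i + 1 ≤ 2 ^ (|r| + 1)` is absorbed by doubling the weight: index `2 * m + 1`
    -- has weight `2 * (m + 1)`.
    refine Summable.of_nonneg_of_le (fun _ => by positivity) (fun r => ?_)
      ((summable_norm_coeff (2 * m + 1) f).comp_injective hinj)
    simp only [Function.comp_apply, norm_mul, map_add, Finsupp.degree_single]
    have h1 : ‖((r i : ℂ) + 1)‖ ≤ 2 ^ (r.degree + 1) := by
      have : ‖((r i : ℂ) + 1)‖ = ((r i + 1 : ℕ) : ℝ) := by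
        rw [← Nat.cast_add_one, Complex.norm_natCast]
      rw [this]
      have h2 : r i + 1 ≤ 2 ^ (r.degree + 1) :=
        (Nat.succ_le_succ (Finsupp.le_degree i r)).trans Nat.lt_two_pow_self.le
      exact_mod_cast h2
    have h3 : ((m + 1 : ℕ) : ℝ) ^ r.degree ≤ ((m + 1 : ℕ) : ℝ) ^ (r.degree + 1) :=
      pow_le_pow_right₀ (by simp) (Nat.le_succ _)
    have h4 : ((2 * m + 1 + 1 : ℕ) : ℝ) = 2 * ((m + 1 : ℕ) : ℝ) := by push_cast; ring
    rw [h4, mul_pow]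
    calc _ = ‖coeff (r + Finsupp.single i 1) f‖ *
        (‖((r i : ℂ) + 1)‖ * ((m + 1 : ℕ) : ℝ) ^ r.degree) := by ring
      _ ≤ _ := by gcongr

@[simp]
theorem coeff_pderiv (i : ℕ) (f : TestAlgebra) (r : ℕ →₀ ℕ) :
    coeff r (pderiv i f) = (r i + 1) * coeff (r + Finsupp.single i 1) f := rfl

/-! ### Weighted sums of coefficients -/

section Pairing

variable {w : (ℕ →₀ ℕ) → ℂ} {m : ℕ}

theorem norm_coeff_mul_weight_le (hw : ∀ r, ‖w r‖ ≤ ((m + 1 : ℕ) : ℝ) ^ r.degree)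
    (f : TestAlgebra) (r : ℕ →₀ ℕ) :
    ‖coeff r f * w r‖ ≤ ‖coeff r f‖ * ((m + 1 : ℕ) : ℝ) ^ r.degree := by
  rw [norm_mul]
  exact mul_le_mul_of_nonneg_left (hw r) (norm_nonneg _)

theorem summable_norm_coeff_mul (hw : ∀ r, ‖w r‖ ≤ ((m + 1 : ℕ) : ℝ) ^ r.degree)
    (f : TestAlgebra) : Summable fun r => ‖coeff r f * w r‖ :=
  Summable.of_nonneg_of_le (fun _ => norm_nonneg _) (norm_coeff_mul_weight_le hw f)
    (summable_norm_coeff m f)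

theorem norm_tsum_coeff_mul_le (hw : ∀ r, ‖w r‖ ≤ ((m + 1 : ℕ) : ℝ) ^ r.degree)
    (f : TestAlgebra) : ‖∑' r, coeff r f * w r‖ ≤ q m f :=
  (norm_tsum_le_tsum_norm (summable_norm_coeff_mul hw f)).trans
    ((summable_norm_coeff_mul hw f).tsum_le_tsum (norm_coeff_mul_weight_le hw f)
      (summable_norm_coeff m f))

end Pairing

/-- Reindexing by `r ↦ r + e_i` moves the derivative from the series to the weight; exponents
outside the image have `r i = 0`. -/
theorem hasSum_coeff_pderiv_mul_iff (i : ℕ) (f : TestAlgebra) (w : (ℕ →₀ ℕ) → ℂ) (c : ℂ) :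
    HasSum (fun r => coeff r (pderiv i f) * w r) c ↔
      HasSum (fun r => coeff r f * ((r i : ℂ) * w (r - Finsupp.single i 1))) c := by
  have hinj : Function.Injective fun r : ℕ →₀ ℕ => r + Finsupp.single i 1 :=
    add_left_injective _
  rw [← hinj.hasSum_iff (f := fun r => coeff r f * ((r i : ℂ) * w (r - Finsupp.single i 1)))]
  · refine iff_of_eq (congrArg (HasSum · c) (funext fun r => ?_))
    simp
    ring
  · intro r hr
    have hi : r i = 0 := by
      by_contra hi
      refine hr ⟨r - Finsupp.single i 1, tsub_add_cancel_of_le ?_⟩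
      simpa [Finsupp.single_le_iff] using Nat.one_le_iff_ne_zero.2 hi
    simp [hi]

end TestAlgebra

/-! ### Substitution of coefficientwise bounded sequences -/

namespace TestAlgebra

/-- The power series `∑ α_r b ^ r` obtained by substituting the sequence `b` in `∑ α_r X ^ r`. -/
noncomputable def subst (b : ℕ → ℂ⟦X⟧) (f : TestAlgebra) : ℂ⟦X⟧ :=
  PowerSeries.mk fun n => ∑' r, coeff r f * PowerSeries.coeff n (monomialEval b r)

theorem coeff_subst (b : ℕ → ℂ⟦X⟧) (f : TestAlgebra) (n : ℕ) :
    PowerSeries.coeff n (subst b f) =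
      ∑' r, coeff r f * PowerSeries.coeff n (monomialEval b r) :=
  PowerSeries.coeff_mk _ _

variable {b : ℕ → ℂ⟦X⟧}

theorem summable_norm_subst (hb : CoeffBounded b) (f : TestAlgebra) (n : ℕ) :
    Summable fun r => ‖coeff r f * PowerSeries.coeff n (monomialEval b r)‖ := by
  obtain ⟨m, hm⟩ := hb.norm_coeff_monomialEval_le n
  exact summable_norm_coeff_mul hm f

theorem hasSum_subst (hb : CoeffBounded b) (f : TestAlgebra) (n : ℕ) :
    HasSum (fun r => coeff r f * PowerSeries.coeff n (monomialEval b r))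
      (PowerSeries.coeff n (subst b f)) := by
  rw [coeff_subst]
  exact (summable_norm_subst hb f n).of_norm.hasSum

theorem hasSum_subst_pderiv (hb : CoeffBounded b) (f : TestAlgebra) (i n : ℕ) :
    HasSum (fun r => coeff r f *
        ((r i : ℂ) * PowerSeries.coeff n (monomialEval b (r - Finsupp.single i 1))))
      (PowerSeries.coeff n (subst b (pderiv i f))) :=
  (hasSum_coeff_pderiv_mul_iff i f (fun r => PowerSeries.coeff n (monomialEval b r)) _).1
    (hasSum_subst hb (pderiv i f) n)

theorem subst_add (hb : CoeffBounded b) (f g : TestAlgebra) :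
    subst b (f + g) = subst b f + subst b g := by
  ext n
  rw [map_add]
  refine (hasSum_subst hb (f + g) n).unique ?_
  refine ((hasSum_subst hb f n).add (hasSum_subst hb g n)).congr_fun ?_
  intro r
  rw [coeff_add, add_mul]

theorem subst_smul (b : ℕ → ℂ⟦X⟧) (c : ℂ) (f : TestAlgebra) :
    subst b (c • f) = c • subst b f := by
  ext n
  rw [PowerSeries.coeff_smul, coeff_subst, coeff_subst, smul_eq_mul, ← tsum_mul_left]
  exact tsum_congr fun r => by rw [coeff_smul, mul_assoc]

theorem coeff_subst_of_support_subset_singleton {f : TestAlgebra} {r : ℕ →₀ ℕ}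
    (h : ∀ s, s ≠ r → coeff s f = 0) : subst b f = coeff r f • monomialEval b r := by
  ext n
  rw [coeff_subst, tsum_eq_single r fun s hs => by rw [h s hs, zero_mul],
    PowerSeries.coeff_smul, smul_eq_mul]

theorem coeff_one (r : ℕ →₀ ℕ) : coeff r 1 = if r = 0 then 1 else 0 := by
  classical
  rw [coeff, map_one, MvPowerSeries.coeff_one]

theorem subst_one (b : ℕ → ℂ⟦X⟧) : subst b 1 = 1 := by
  rw [coeff_subst_of_support_subset_singleton (r := 0) fun s hs => by rw [coeff_one, if_neg hs],
    coeff_one, if_pos rfl, one_smul, monomialEval_zero]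

theorem subst_mul (hb : CoeffBounded b) (f g : TestAlgebra) :
    subst b (f * g) = subst b f * subst b g := by
  ext n
  have hs (k l : ℕ) := summable_mul_of_summable_norm (summable_norm_subst hb f k)
    (summable_norm_subst hb g l)
  have hp (k l : ℕ) := summable_sum_mul_antidiagonal_of_summable_mul
      (f := fun r => coeff r f * PowerSeries.coeff k (monomialEval b r))
      (g := fun r => coeff r g * PowerSeries.coeff l (monomialEval b r)) (hs k l)
  rw [PowerSeries.coeff_mul]
  have h := hasSum_sum fun (p : ℕ × ℕ) (_ : p ∈ Finset.HasAntidiagonal.antidiagonal n) =>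
    (hp p.1 p.2).hasSum
  have h2 (k l : ℕ) := (hasSum_subst hb f k).summable.tsum_mul_tsum_eq_tsum_sum_antidiagonal
    (hasSum_subst hb g l).summable (hs k l)
  simp_rw [← h2, ← coeff_subst] at h
  refine (hasSum_subst hb (f * g) n).unique (h.congr_fun fun r => ?_)
  rw [coeff_mul, Finset.sum_mul, Finset.sum_comm]
  refine Finset.sum_congr rfl fun p hp => ?_
  rw [← Finset.HasAntidiagonal.mem_antidiagonal.1 hp, monomialEval_add, PowerSeries.coeff_mul,
    Finset.mul_sum]
  exact Finset.sum_congr rfl fun _ _ => by ring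

/-- Substitution as an algebra homomorphism. -/
noncomputable def substAlgHom (hb : CoeffBounded b) : TestAlgebra →ₐ[ℂ] ℂ⟦X⟧ :=
  AlgHom.ofLinearMap ⟨⟨subst b, subst_add hb⟩, subst_smul b⟩ (subst_one b) (subst_mul hb)

@[simp]
theorem substAlgHom_apply (hb : CoeffBounded b) (f : TestAlgebra) :
    substAlgHom hb f = subst b f := rfl

theorem continuous_substAlgHom (hb : CoeffBounded b) : Continuous (substAlgHom hb) := by
  refine continuous_iff_continuousAt.2 fun f =>
    (PowerSeries.WithPiTopology.tendsto_iff_coeff_tendsto ℂ _ _ _).2 fun n => ?_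
  obtain ⟨m, hm⟩ := hb.norm_coeff_monomialEval_le n
  have h : Continuous ((PowerSeries.coeff n).comp (substAlgHom hb).toLinearMap) := by
    refine withSeminorms_q.continuous_normedSpace_rng _ _ ⟨{m}, 1, fun g => ?_⟩
    simpa [coeff_subst] using norm_tsum_coeff_mul_le hm g
  exact h.continuousAt

end TestAlgebra

/-! ### A sequence of lacunary power series without analytic relations -/

/-- Turns statements about low coefficients into identities in a quotient ring, through which
`monomialEval` passes. -/
theorem PowerSeries.mk_span_X_pow_eq_iff {R : Type*} [CommRing R] {M : ℕ} {f g : R⟦X⟧} :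
    Ideal.Quotient.mk (Ideal.span {(PowerSeries.X : R⟦X⟧) ^ M}) f = Ideal.Quotient.mk _ g ↔
      ∀ k < M, PowerSeries.coeff k f = PowerSeries.coeff k g := by
  rw [Ideal.Quotient.eq, Ideal.mem_span_singleton, PowerSeries.X_pow_dvd_iff]
  simp [sub_eq_zero]

theorem coeff_monomialEval_congr {M : ℕ} {b b' : ℕ → ℂ⟦X⟧}
    (h : ∀ j, ∀ k < M, PowerSeries.coeff k (b j) = PowerSeries.coeff k (b' j))
    {k : ℕ} (hk : k < M) (r : ℕ →₀ ℕ) :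
    PowerSeries.coeff k (monomialEval b r) = PowerSeries.coeff k (monomialEval b' r) := by
  refine PowerSeries.mk_span_X_pow_eq_iff.1 ?_ k hk
  rw [map_monomialEval, map_monomialEval]
  exact congrArg (monomialEval · r) (funext fun j => PowerSeries.mk_span_X_pow_eq_iff.2 (h j))

/-- Modulo `X ^ (2 * n)`, `b` is `s` with `c X ^ n` added in slot `i`, and `c X ^ n` has square
zero, so the Taylor expansion stops at first order. The derivative term is read only in degree `d <
n`, where `s` may be replaced by `b`. -/
theorem coeff_monomialEval_of_lacunary {n i : ℕ} {c : ℂ} {b s : ℕ → ℂ⟦X⟧}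
    (hlow : ∀ j, ∀ k < n, PowerSeries.coeff k (b j) = PowerSeries.coeff k (s j))
    (h : ∀ j, ∀ k < 2 * n, PowerSeries.coeff k (b j) =
      PowerSeries.coeff k (s j) + if j = i ∧ k = n then c else 0)
    {d : ℕ} (hd : d < n) (r : ℕ →₀ ℕ) :
    PowerSeries.coeff (d + n) (monomialEval b r) = PowerSeries.coeff (d + n) (monomialEval s r) +
      c * ((r i : ℂ) * PowerSeries.coeff d (monomialEval b (r - Finsupp.single i 1))) := by
  set φ := Ideal.Quotient.mk (Ideal.span {(PowerSeries.X : ℂ⟦X⟧) ^ (2 * n)}) with hφ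
  set y : ℂ⟦X⟧ := PowerSeries.C c * PowerSeries.X ^ n with hy
  have hx : φ y ^ 2 = 0 := by
    rw [← map_pow, hφ, Ideal.Quotient.eq_zero_iff_mem, Ideal.mem_span_singleton, hy, mul_pow,
      ← pow_mul, mul_comm n 2]
    exact dvd_mul_left _ _
  have hb (j : ℕ) : φ (b j) = φ (s j) + if j = i then φ y else 0 := by
    rw [← map_zero φ, ← apply_ite φ, ← map_add, hφ, PowerSeries.mk_span_X_pow_eq_iff]
    intro k hk
    rw [h j k hk, map_add]
    by_cases hj : j = i
    · simp [hj, hy, PowerSeries.coeff_X_pow]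
    · simp [hj]
  have key : φ (monomialEval b r) =
      φ (monomialEval s r + (r i : ℂ⟦X⟧) * monomialEval s (r - Finsupp.single i 1) * y) := by
    rw [map_monomialEval, funext hb, monomialEval_add_of_sq_eq_zero _ hx, map_add φ,
      map_mul φ _ y, map_mul φ (r i : ℂ⟦X⟧), map_monomialEval, map_monomialEval, map_natCast]
  rw [PowerSeries.mk_span_X_pow_eq_iff.1 key (d + n) (by omega), map_add,
    coeff_monomialEval_congr hlow hd, hy, ← mul_assoc, PowerSeries.coeff_mul_X_pow,
    PowerSeries.coeff_mul_C, ← map_natCast (PowerSeries.C (R := ℂ)), PowerSeries.coeff_C_mul]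
  ring

/-! ### Construction and growth of the lacunary series -/

/-- A bound for the sum of the first `K` lacunary coefficients. -/
def lacunaryBound : ℕ → ℕ
  | 0 => 1
  | K + 1 => lacunaryBound K + (K + 1) * lacunaryBound K ^ (2 ^ (K + 1))

/-- A very rapidly growing sequence of coefficients. -/
def lacunaryCoeff (K : ℕ) : ℕ := (K + 1) * lacunaryBound K ^ (2 ^ (K + 1))

/-- A sequence of indices which attains `0` once, at `0`, and every other index infinitely often. -/
def lacunaryIndex : ℕ → ℕ
  | 0 => 0
  | K + 1 => (Nat.unpair K).1 + 1

theorem lacunaryIndex_le (K : ℕ) : lacunaryIndex K ≤ K := by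
  cases K with
  | zero => exact le_rfl
  | succ K => exact Nat.succ_le_succ (Nat.unpair_left_le K)

theorem exists_lacunaryIndex_eq (i B : ℕ) : ∃ K, B ≤ K ∧ lacunaryIndex K = i + 1 :=
  ⟨Nat.pair i B + 1, (Nat.right_le_pair i B).trans (Nat.le_succ _), by simp [lacunaryIndex]⟩

theorem sum_lacunaryCoeff_add_one (K : ℕ) :
    ∑ L ∈ Finset.range K, lacunaryCoeff L + 1 = lacunaryBound K := by
  induction K with
  | zero => simp [lacunaryBound]
  | succ K ih => rw [Finset.sum_range_succ, lacunaryBound, lacunaryCoeff, ← ih]; ring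

theorem one_le_lacunaryBound (K : ℕ) : 1 ≤ lacunaryBound K := by
  rw [← sum_lacunaryCoeff_add_one]
  exact Nat.le_add_left 1 _

/-- The lacunary power series `∑ c_K X ^ (2 ^ K)`, the sum being over the `K` with index `j`. -/
noncomputable def lacunarySeries (j : ℕ) : ℂ⟦X⟧ := PowerSeries.mk fun n =>
  if n = 2 ^ Nat.log 2 n ∧ lacunaryIndex (Nat.log 2 n) = j then
    (lacunaryCoeff (Nat.log 2 n) : ℂ) else 0

/-- The part of `lacunarySeries` of degree less than `2 ^ K`. -/
noncomputable def lacunaryTrunc (K j : ℕ) : ℂ⟦X⟧ := PowerSeries.mk fun n =>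
  if n < 2 ^ K then PowerSeries.coeff n (lacunarySeries j) else 0

theorem coeff_two_pow_lacunarySeries (K j : ℕ) :
    PowerSeries.coeff (2 ^ K) (lacunarySeries j) =
      if lacunaryIndex K = j then (lacunaryCoeff K : ℂ) else 0 := by
  rw [lacunarySeries, PowerSeries.coeff_mk, Nat.log_pow one_lt_two]
  simp

theorem exists_eq_two_pow_of_coeff_lacunarySeries_ne_zero {n j : ℕ}
    (h : PowerSeries.coeff n (lacunarySeries j) ≠ 0) : ∃ K, n = 2 ^ K ∧ lacunaryIndex K = j := by
  rw [lacunarySeries, PowerSeries.coeff_mk] at h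
  exact ⟨Nat.log 2 n, of_not_not fun h' => h (if_neg h')⟩

theorem lt_of_coeff_lacunarySeries_ne_zero {n j : ℕ}
    (h : PowerSeries.coeff n (lacunarySeries j) ≠ 0) : j < n := by
  obtain ⟨K, rfl, rfl⟩ := exists_eq_two_pow_of_coeff_lacunarySeries_ne_zero h
  exact (lacunaryIndex_le K).trans_lt Nat.lt_two_pow_self

theorem norm_coeff_two_pow_lacunarySeries_le (K j : ℕ) :
    ‖PowerSeries.coeff (2 ^ K) (lacunarySeries j)‖ ≤ lacunaryCoeff K := by
  rw [coeff_two_pow_lacunarySeries]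
  split_ifs <;> simp

/-- Only `K = 0` has index `0`, and `c_0 = 1`. This puts `X` in the image of the substitution. -/
theorem lacunarySeries_zero : lacunarySeries 0 = PowerSeries.X := by
  ext n
  rw [PowerSeries.coeff_X]
  by_cases h : PowerSeries.coeff n (lacunarySeries 0) = 0
  · rw [h, if_neg]
    rintro rfl
    have := coeff_two_pow_lacunarySeries 0 0
    rw [pow_zero, h] at this
    simp [lacunaryIndex, lacunaryCoeff, lacunaryBound] at this
  · obtain ⟨K, rfl, hK⟩ := exists_eq_two_pow_of_coeff_lacunarySeries_ne_zero h
    cases K with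
    | zero =>
      rw [coeff_two_pow_lacunarySeries]
      simp [lacunaryIndex, lacunaryCoeff, lacunaryBound]
    | succ K => simp [lacunaryIndex] at hK

theorem coeffBounded_lacunarySeries : CoeffBounded lacunarySeries := fun n =>
  ⟨lacunaryCoeff (Nat.log 2 n), fun j => by
    rw [lacunarySeries, PowerSeries.coeff_mk]
    split_ifs <;> simp⟩

theorem coeffBounded_lacunaryTrunc (K : ℕ) : CoeffBounded (lacunaryTrunc K) := fun n => by
  obtain ⟨C, hC⟩ := coeffBounded_lacunarySeries n
  refine ⟨C, fun j => ?_⟩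
  rw [lacunaryTrunc, PowerSeries.coeff_mk]
  split_ifs
  · exact hC j
  · simpa using (norm_nonneg _).trans (hC j)

/-- Since `ρ ≤ 1`, each term `c_L ρ ^ (2 ^ L)` is at most `c_L ρ`, and the `c_L` with `L < K` add up
to less than `ρ⁻¹`. The bound `1` makes all monomials in the truncations have norm at most `1`,
whatever their degree. -/
theorem truncNorm_lacunaryTrunc_le (K n j : ℕ) :
    truncNorm (lacunaryBound K : ℝ)⁻¹ n (lacunaryTrunc K j) ≤ 1 := by
  have hT : (1 : ℝ) ≤ lacunaryBound K := by exact_mod_cast one_le_lacunaryBound K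
  set ρ : ℝ := (lacunaryBound K : ℝ)⁻¹ with hρ
  have hρ0 : 0 ≤ ρ := by positivity
  have hρ1 : ρ ≤ 1 := inv_le_one_of_one_le₀ hT
  calc truncNorm ρ n (lacunaryTrunc K j)
      ≤ ∑ k ∈ (Finset.range K).image (2 ^ ·),
          ‖PowerSeries.coeff k (lacunarySeries j)‖ * ρ ^ k := by
        unfold truncNorm
        refine (Finset.sum_le_sum (g := fun k => if k < 2 ^ K then
          ‖PowerSeries.coeff k (lacunarySeries j)‖ * ρ ^ k else 0) fun k _ => ?_).trans ?_
        · rw [lacunaryTrunc, PowerSeries.coeff_mk]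
          split_ifs <;> simp
        · rw [← Finset.sum_filter, ← Finset.sum_filter_ne_zero]
          refine Finset.sum_le_sum_of_subset_of_nonneg (fun k hk => ?_) fun _ _ _ => by positivity
          obtain ⟨hk, hne⟩ := Finset.mem_filter.1 hk
          obtain ⟨L, rfl, -⟩ := exists_eq_two_pow_of_coeff_lacunarySeries_ne_zero
            (norm_ne_zero_iff.1 (left_ne_zero_of_mul hne))
          have := (Nat.pow_lt_pow_iff_right one_lt_two).1 (Finset.mem_filter.1 hk).2
          exact Finset.mem_image_of_mem _ (Finset.mem_range.2 this)
    _ = ∑ L ∈ Finset.range K,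
          ‖PowerSeries.coeff (2 ^ L) (lacunarySeries j)‖ * ρ ^ (2 ^ L) :=
        Finset.sum_image fun _ _ _ _ h => Nat.pow_right_injective le_rfl h
    _ ≤ ∑ L ∈ Finset.range K, (lacunaryCoeff L : ℝ) * ρ := by
        refine Finset.sum_le_sum fun L _ => ?_
        refine mul_le_mul (norm_coeff_two_pow_lacunarySeries_le L j) ?_ (by positivity)
          (by positivity)
        exact pow_le_of_le_one hρ0 hρ1 (by positivity)
    _ ≤ lacunaryBound K * ρ := by
        rw [← Finset.sum_mul, ← sum_lacunaryCoeff_add_one]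
        push_cast
        exact mul_le_mul_of_nonneg_right (le_add_of_nonneg_right zero_le_one) hρ0
    _ = 1 := mul_inv_cancel₀ (by positivity)

theorem norm_coeff_monomialEval_lacunaryTrunc_le (K n : ℕ) (r : ℕ →₀ ℕ) :
    ‖PowerSeries.coeff n (monomialEval (lacunaryTrunc K) r)‖ ≤ (lacunaryBound K : ℝ) ^ n := by
  have hT : (1 : ℝ) ≤ lacunaryBound K := by exact_mod_cast one_le_lacunaryBound K
  have h := (norm_coeff_mul_pow_le_truncNorm (inv_nonneg.2 (zero_le_one.trans hT)) n _).trans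
    (truncNorm_monomialEval_le (inv_nonneg.2 (zero_le_one.trans hT))
      (truncNorm_lacunaryTrunc_le K n) r)
  rw [one_pow, inv_pow] at h
  rwa [mul_inv_le_iff₀ (by positivity), one_mul] at h

theorem coeff_lacunarySeries_eq (K j k : ℕ) (hk : k < 2 * 2 ^ K) :
    PowerSeries.coeff k (lacunarySeries j) = PowerSeries.coeff k (lacunaryTrunc K j) +
      if j = lacunaryIndex K ∧ k = 2 ^ K then (lacunaryCoeff K : ℂ) else 0 := by
  rw [lacunaryTrunc, PowerSeries.coeff_mk]
  rcases lt_trichotomy k (2 ^ K) with h | rfl | h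
  · simp [h, h.ne]
  · simp [coeff_two_pow_lacunarySeries, eq_comm]
  · rw [if_neg h.not_gt, if_neg fun h' => h.ne' h'.2, add_zero]
    by_contra hne
    obtain ⟨L, rfl, -⟩ := exists_eq_two_pow_of_coeff_lacunarySeries_ne_zero hne
    rw [← pow_succ', Nat.pow_lt_pow_iff_right one_lt_two] at hk
    have := (Nat.pow_lt_pow_iff_right one_lt_two).1 h
    omega

theorem coeff_monomialEval_lacunarySeries {K d : ℕ} (hd : d < 2 ^ K) (r : ℕ →₀ ℕ) :
    PowerSeries.coeff (d + 2 ^ K) (monomialEval lacunarySeries r) =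
      PowerSeries.coeff (d + 2 ^ K) (monomialEval (lacunaryTrunc K) r) +
        lacunaryCoeff K * ((r (lacunaryIndex K) : ℂ) * PowerSeries.coeff d
          (monomialEval lacunarySeries (r - Finsupp.single (lacunaryIndex K) 1))) := by
  refine coeff_monomialEval_of_lacunary (fun j k hk => ?_) (coeff_lacunarySeries_eq K) hd r
  rw [lacunaryTrunc, PowerSeries.coeff_mk, if_pos hk]

/-! ### Injectivity of substitution at the lacunary series -/

namespace TestAlgebra

theorem norm_coeff_subst_lacunaryTrunc_le (K n : ℕ) (f : TestAlgebra) :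
    ‖PowerSeries.coeff n (subst (lacunaryTrunc K) f)‖ ≤ (lacunaryBound K : ℝ) ^ n * q 0 f := by
  have hT : (1 : ℝ) ≤ lacunaryBound K := by exact_mod_cast one_le_lacunaryBound K
  rw [coeff_subst, q_apply, ← tsum_mul_left]
  refine tsum_of_norm_bounded ((summable_norm_coeff 0 f).mul_left _).hasSum fun r => ?_
  rw [norm_mul, mul_comm]
  refine mul_le_mul (norm_coeff_monomialEval_lacunaryTrunc_le K n r) ?_ (norm_nonneg _)
    (by positivity)
  simp

theorem coeff_subst_lacunarySeries (f : TestAlgebra) {K d : ℕ} (hd : d < 2 ^ K) :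
    PowerSeries.coeff (d + 2 ^ K) (subst lacunarySeries f) =
      PowerSeries.coeff (d + 2 ^ K) (subst (lacunaryTrunc K) f) +
        lacunaryCoeff K *
          PowerSeries.coeff d (subst lacunarySeries (pderiv (lacunaryIndex K) f)) := by
  refine (hasSum_subst coeffBounded_lacunarySeries f _).unique ?_
  refine ((hasSum_subst (coeffBounded_lacunaryTrunc K) f _).add
    ((hasSum_subst_pderiv coeffBounded_lacunarySeries f _ d).mul_left _)).congr_fun fun r => ?_
  rw [coeff_monomialEval_lacunarySeries hd]
  ring

/-- In degree `d + 2 ^ K` the two contributions cancel. As `d + 2 ^ K ≤ 2 ^ (K + 1)`, the factor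
`lacunaryBound K ^ (2 ^ (K + 1))` in `c_K` cancels the bound on the truncated part. The remaining
factor `K + 1` is unbounded over the `K` of index `i + 1`, while `q 0 f` is fixed. -/
theorem subst_lacunarySeries_pderiv_succ {f : TestAlgebra} (hf : subst lacunarySeries f = 0)
    (i : ℕ) : subst lacunarySeries (pderiv (i + 1) f) = 0 := by
  ext d
  by_contra hne
  rw [map_zero] at hne
  have hpos := norm_pos_iff.2 hne
  obtain ⟨B, hB⟩ := exists_nat_gt
    (q 0 f / ‖PowerSeries.coeff d (subst lacunarySeries (pderiv (i + 1) f))‖)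
  -- `K ≥ B` contradicts the final estimate `h3`; `K ≥ d` ensures `d < 2 ^ K`.
  obtain ⟨K, hK, hi⟩ := exists_lacunaryIndex_eq i (max B d)
  have hT : (1 : ℝ) ≤ lacunaryBound K := by exact_mod_cast one_le_lacunaryBound K
  have hd : d < 2 ^ K := ((le_max_right B d).trans hK).trans_lt Nat.lt_two_pow_self
  have h := coeff_subst_lacunarySeries f hd
  rw [hf, map_zero, hi, eq_comm, add_eq_zero_iff_neg_eq] at h
  have h1 := norm_coeff_subst_lacunaryTrunc_le K (d + 2 ^ K) f
  rw [← norm_neg, h, norm_mul, Complex.norm_natCast, lacunaryCoeff] at h1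
  have h2 : (lacunaryBound K : ℝ) ^ (d + 2 ^ K) ≤ (lacunaryBound K : ℝ) ^ (2 ^ (K + 1)) :=
    pow_le_pow_right₀ hT (by rw [pow_succ]; omega)
  have h3 : ((K + 1 : ℕ) : ℝ) *
      ‖PowerSeries.coeff d (subst lacunarySeries (pderiv (i + 1) f))‖ ≤ q 0 f := by
    have hp : (0 : ℝ) < (lacunaryBound K : ℝ) ^ (2 ^ (K + 1)) := by positivity
    refine le_of_mul_le_mul_left ?_ hp
    refine le_trans (le_of_eq ?_) (h1.trans (mul_le_mul_of_nonneg_right h2 (apply_nonneg _ _)))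
    push_cast
    ring
  rw [div_lt_iff₀ hpos] at hB
  have h4 : (B : ℝ) ≤ ((K + 1 : ℕ) : ℝ) := by
    exact_mod_cast ((le_max_left B d).trans hK).trans (Nat.le_succ K)
  nlinarith

/-- The chain rule, for sequences with only finitely many terms of each order. -/
theorem coeff_derivative_subst {b : ℕ → ℂ⟦X⟧} (hb : CoeffBounded b)
    (hb' : ∀ n j, n ≤ j → PowerSeries.coeff n (b j) = 0) (f : TestAlgebra) (n : ℕ) :
    PowerSeries.coeff n (PowerSeries.derivative ℂ (subst b f)) =
      ∑ i ∈ Finset.range (n + 1),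
        PowerSeries.coeff n (subst b (pderiv i f) * PowerSeries.derivative ℂ (b i)) := by
  have hmon (r : ℕ →₀ ℕ) :
      PowerSeries.coeff n (PowerSeries.derivative ℂ (monomialEval b r)) =
        ∑ i ∈ Finset.range (n + 1), ∑ p ∈ Finset.HasAntidiagonal.antidiagonal n,
          (r i : ℂ) * PowerSeries.coeff p.1 (monomialEval b (r - Finsupp.single i 1)) *
            PowerSeries.coeff p.2 (PowerSeries.derivative ℂ (b i)) := by
    rw [Derivation.monomialEval_apply _ b (s := r.support ∪ Finset.range (n + 1)) r
      Finset.subset_union_left, map_sum]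
    have hterm (i : ℕ) : PowerSeries.coeff n ((r i : ℂ⟦X⟧) *
        monomialEval b (r - Finsupp.single i 1) * PowerSeries.derivative ℂ (b i)) =
        ∑ p ∈ Finset.HasAntidiagonal.antidiagonal n,
          (r i : ℂ) * PowerSeries.coeff p.1 (monomialEval b (r - Finsupp.single i 1)) *
            PowerSeries.coeff p.2 (PowerSeries.derivative ℂ (b i)) := by
      rw [PowerSeries.coeff_mul]
      refine Finset.sum_congr rfl fun p _ => ?_
      rw [← map_natCast (PowerSeries.C (R := ℂ)), PowerSeries.coeff_C_mul]
    rw [Finset.sum_congr rfl fun i _ => hterm i]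
    -- For `i > n` the derivative of `b i` has no coefficient of degree at most `n`, so a range
    -- independent of `r` suffices.
    refine (Finset.sum_subset Finset.subset_union_right fun i _ hi => ?_).symm
    refine Finset.sum_eq_zero fun p hp => ?_
    have hp2 := Finset.HasAntidiagonal.mem_antidiagonal.1 hp
    have hi' : n + 1 ≤ i := by simpa using hi
    rw [PowerSeries.coeff_derivative, hb' _ _ (by omega), zero_mul, mul_zero]
  rw [PowerSeries.coeff_derivative]
  refine ((hasSum_subst hb f (n + 1)).mul_right _).unique ?_
  simp_rw [PowerSeries.coeff_mul]
  have h := hasSum_sum fun (i : ℕ) (_ : i ∈ Finset.range (n + 1)) =>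
    hasSum_sum fun (p : ℕ × ℕ) (_ : p ∈ Finset.HasAntidiagonal.antidiagonal n) =>
      (hasSum_subst_pderiv hb f i p.1).mul_right
        (PowerSeries.coeff p.2 (PowerSeries.derivative ℂ (b i)))
  refine h.congr_fun fun r => ?_
  have := hmon r
  rw [PowerSeries.coeff_derivative] at this
  rw [mul_assoc, this, Finset.mul_sum]
  refine Finset.sum_congr rfl fun i _ => ?_
  rw [Finset.mul_sum]
  exact Finset.sum_congr rfl fun p _ => by ring

/-- The growth argument misses `i = 0`, whose series is just `X`. There the chain rule applied to
`f(b) = 0` leaves only the term `(∂_0 f)(b) * X' = (∂_0 f)(b)`. -/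
theorem subst_lacunarySeries_pderiv {f : TestAlgebra} (hf : subst lacunarySeries f = 0) (i : ℕ) :
    subst lacunarySeries (pderiv i f) = 0 := by
  cases i with
  | succ i => exact subst_lacunarySeries_pderiv_succ hf i
  | zero =>
    ext n
    have h := coeff_derivative_subst coeffBounded_lacunarySeries
      (fun n j hnj => by
        by_contra hne
        exact absurd (lt_of_coeff_lacunarySeries_ne_zero hne) hnj.not_gt) f n
    rw [hf, map_zero, Finset.sum_range_succ', Finset.sum_eq_zero fun i _ => by
      rw [subst_lacunarySeries_pderiv_succ hf, zero_mul, map_zero], zero_add,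
      lacunarySeries_zero, PowerSeries.derivative_X, mul_one] at h
    exact h.symm

theorem eq_zero_of_subst_lacunarySeries_eq_zero {f : TestAlgebra}
    (hf : subst lacunarySeries f = 0) : f = 0 := by
  -- The induction is over all `f` at once: the coefficient at `r + e_i` is, up to a nonzero factor,
  -- the coefficient at `r` of `∂_i f`, again in the kernel.
  have key (r : ℕ →₀ ℕ) : ∀ f : TestAlgebra, subst lacunarySeries f = 0 → coeff r f = 0 := by
    induction r using Finsupp.induction_add_single_one with
    | zero =>
      intro f hf
      have h := coeff_subst lacunarySeries f 0
      rw [hf, tsum_eq_single 0, monomialEval_zero] at h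
      · simpa using h.symm
      · intro r hr
        obtain ⟨i, hi⟩ : ∃ i, r i ≠ 0 := by
          by_contra! h0
          exact hr (Finsupp.ext h0)
        rw [PowerSeries.coeff_zero_eq_constantCoeff_apply, map_monomialEval, monomialEval,
          Finsupp.prod, Finset.prod_eq_zero (Finsupp.mem_support_iff.2 hi), mul_zero]
        rw [← PowerSeries.coeff_zero_eq_constantCoeff_apply]
        by_contra hne
        exact Nat.not_lt_zero _ (lt_of_coeff_lacunarySeries_ne_zero
          (ne_of_apply_ne (· ^ r i) (by rwa [zero_pow hi])))
    | add r i ih =>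
      intro f hf
      have h := ih (pderiv i f) (subst_lacunarySeries_pderiv hf i)
      rw [coeff_pderiv] at h
      exact (mul_eq_zero.1 h).resolve_left (Nat.cast_add_one_ne_zero _)
  ext r
  rw [key r f hf]
  simp [coeff]

end TestAlgebra

namespace TestAlgebra

/-! ### Extension of continuous linear maps from the 1-homogeneous series -/

/-- The indeterminate `X_i`, as a 1-homogeneous series. -/
noncomputable def degreeOneX (i : ℕ) : degreeOne :=
  ⟨mk (fun r => if r = Finsupp.single i 1 then 1 else 0) fun m =>
      summable_of_ne_finset_zero (s := {Finsupp.single i 1}) fun s hs => by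
        have hs' : s ≠ Finsupp.single i 1 := by simpa using hs
        simp [hs'],
    fun r hr => if_neg fun h => hr (by rw [h, Finsupp.degree_single])⟩

theorem coeff_degreeOneX (i : ℕ) (r : ℕ →₀ ℕ) :
    coeff r (degreeOneX i : TestAlgebra) = if r = Finsupp.single i 1 then 1 else 0 := rfl

theorem q_degreeOneX (m i : ℕ) : q m (degreeOneX i : TestAlgebra) = m + 1 := by
  rw [q_apply, tsum_eq_single (Finsupp.single i 1)]
  · simp [coeff_degreeOneX]
  · intro r hr
    simp [coeff_degreeOneX, hr]

/-- Each coefficient functional of `β` is bounded by finitely many norms `q m`, and `q m (X_i) = m +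
1` does not depend on `i`. -/
theorem coeffBounded_of_continuous (β : degreeOne →L[ℂ] ℂ⟦X⟧) :
    CoeffBounded fun i => β (degreeOneX i) := fun n => by
  have hind := LinearMap.withSeminorms_induced withSeminorms_q degreeOne.subtype
  obtain ⟨s, C, -, hC⟩ := Seminorm.bound_of_continuous hind
    ((normSeminorm ℂ ℂ).comp ((PowerSeries.coeff n).comp β.toLinearMap))
    (((PowerSeries.WithPiTopology.continuous_coeff ℂ n).comp β.continuous).norm)
  refine ⟨C * (s.sup id + 1 : ℕ), fun i => (hC (degreeOneX i)).trans ?_⟩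
  refine mul_le_mul_of_nonneg_left ?_ C.2
  refine Seminorm.finset_sup_apply_le (by positivity) fun m hm => ?_
  refine (q_degreeOneX m i).le.trans ?_
  exact_mod_cast Nat.succ_le_succ (Finset.le_sup (f := id) hm)

/-- The term `α_r X ^ r` of a 1-homogeneous series. -/
noncomputable def degreeOneTerm (f : degreeOne) (r : ℕ →₀ ℕ) : degreeOne :=
  ⟨term f r, fun s hs => by
    change (if s = r then coeff r (f : TestAlgebra) else 0) = 0
    split_ifs with h
    · rw [← h]
      exact f.2 s hs
    · rfl⟩

theorem hasSum_degreeOneTerm (f : degreeOne) : HasSum (degreeOneTerm f) f :=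
  (Topology.IsInducing.hasSum_iff (g := degreeOne.subtype) Topology.IsInducing.subtypeVal
    (degreeOneTerm f) f).1 (hasSum_term f)

theorem exists_eq_single_of_degree_eq_one {r : ℕ →₀ ℕ} (hr : r.degree = 1) :
    ∃ i, r = Finsupp.single i 1 := by
  revert hr
  refine Finsupp.induction_add_single_one
    (P := fun r => r.degree = 1 → ∃ i, r = Finsupp.single i 1) ?_ ?_ r
  · simp
  · intro r i _ hr
    rw [map_add, Finsupp.degree_single, Nat.add_eq_right, Finsupp.degree_eq_zero_iff] at hr
    exact ⟨i, by rw [hr, zero_add]⟩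

/-- Continuity of `β` lets it act termwise on the convergent expansion `∑ α_i X_i`; terms of degree
other than one vanish on both sides. -/
theorem subst_eq_of_degreeOne (β : degreeOne →L[ℂ] ℂ⟦X⟧) (f : degreeOne) :
    subst (fun i => β (degreeOneX i)) (f : TestAlgebra) = β f := by
  ext n
  refine (hasSum_subst (coeffBounded_of_continuous β) (f : TestAlgebra) n).unique ?_
  refine ((PowerSeries.WithPiTopology.hasSum_iff_hasSum_coeff ℂ).1
    ((hasSum_degreeOneTerm f).mapL β) n).congr_fun fun r => ?_
  by_cases hr : r.degree = 1
  · obtain ⟨i, rfl⟩ := exists_eq_single_of_degree_eq_one hr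
    have h : degreeOneTerm f (Finsupp.single i 1) =
        coeff (Finsupp.single i 1) (f : TestAlgebra) • degreeOneX i := by
      refine Subtype.ext (ext fun s => ?_)
      rw [Submodule.coe_smul, coeff_smul, coeff_degreeOneX]
      change (if s = _ then _ else _) = _
      split_ifs <;> simp
    rw [monomialEval_single_one, h, map_smul, PowerSeries.coeff_smul, smul_eq_mul]
  · have h0 : coeff r (f : TestAlgebra) = 0 := f.2 r hr
    have h : degreeOneTerm f r = 0 := by
      refine Subtype.ext (ext fun s => ?_)
      change (if s = r then coeff r (f : TestAlgebra) else 0) = 0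
      rw [h0, ite_self]
    rw [h0, h, map_zero, map_zero, zero_mul]

/-! ### The test algebra as an algebra of power series -/

theorem substAlgHom_lacunarySeries_injective :
    Function.Injective (substAlgHom coeffBounded_lacunarySeries) :=
  (injective_iff_map_eq_zero _).2 fun _ => eq_zero_of_subst_lacunarySeries_eq_zero

theorem subst_degreeOneX (b : ℕ → ℂ⟦X⟧) (i : ℕ) : subst b (degreeOneX i : TestAlgebra) = b i := by
  rw [coeff_subst_of_support_subset_singleton (r := Finsupp.single i 1) fun s hs => by
    rw [coeff_degreeOneX, if_neg hs], coeff_degreeOneX, if_pos rfl, one_smul,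
    monomialEval_single_one]

theorem isFrechetAlgebra_induced {A : Type*} [CommRing A] [Algebra ℂ A]
    (Ψ : A ≃ₐ[ℂ] TestAlgebra) :
    IsFrechetAlgebra A (TopologicalSpace.induced Ψ inferInstance)
      (q.comp Ψ.toLinearMap) where
  monotone _ _ h a := q_monotone h (Ψ a)
  submultiplicative m a b := (congrArg (q m) (map_mul Ψ a b)).trans_le (q_mul_le m (Ψ a) (Ψ b))
  withSeminorms := LinearMap.withSeminorms_induced withSeminorms_q Ψ.toLinearMap
  separated a h := (map_eq_zero_iff Ψ Ψ.injective).1 (eq_zero_of_q_eq_zero (h 0))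
  complete u hu := by
    obtain ⟨f, hf⟩ := exists_tendsto_of_cauchy (fun i => Ψ (u i)) fun m ε hε => by
      obtain ⟨N, hN⟩ := hu m ε hε
      refine ⟨N, fun i hi j hj => ?_⟩
      rw [← map_sub]
      exact hN i hi j hj
    refine ⟨Ψ.symm f, ?_⟩
    rw [nhds_induced, Filter.tendsto_comap_iff, AlgEquiv.apply_symm_apply]
    exact hf

end TestAlgebra

theorem mainTheorem11 :
    (∀ β : TestAlgebra.degreeOne →L[ℂ] ℂ⟦X⟧,
      ∃ βbar : TestAlgebra →ₐ[ℂ] ℂ⟦X⟧, Continuous βbar ∧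
        ∀ f : TestAlgebra.degreeOne, βbar (f : TestAlgebra) = β f) ∧
    (∃ (A : Subalgebra ℂ ℂ⟦X⟧) (τ : TopologicalSpace A) (p : SeminormFamily ℂ A ℕ),
      IsFrechetAlgebraOfPowerSeries A τ p ∧
        ∃ Φ : TestAlgebra ≃ₐ[ℂ] A,
          Continuous[TestAlgebra.instTopologicalSpace, τ] Φ ∧ Continuous[τ, TestAlgebra.instTopologicalSpace] Φ.symm ∧
            ∀ (m : ℕ) (f : TestAlgebra), p m (Φ f) = TestAlgebra.q m f) := by
  refine ⟨fun β => ⟨TestAlgebra.substAlgHom (TestAlgebra.coeffBounded_of_continuous β),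
    TestAlgebra.continuous_substAlgHom _, TestAlgebra.subst_eq_of_degreeOne β⟩, ?_⟩
  set Φ := AlgEquiv.ofInjective (TestAlgebra.substAlgHom coeffBounded_lacunarySeries)
    TestAlgebra.substAlgHom_lacunarySeries_injective
  -- Topology and seminorms are transported along `Φ`, which makes it an isometric homeomorphism.
  -- The inclusion of the image is continuous because composing it with `Φ` gives the substitution
  -- map.
  refine ⟨_, TopologicalSpace.induced Φ.symm TestAlgebra.instTopologicalSpace,
    TestAlgebra.q.comp Φ.symm.toLinearMap,
    ⟨⟨(TestAlgebra.degreeOneX 0 : TestAlgebra), ?_⟩, TestAlgebra.isFrechetAlgebra_induced Φ.symm, ?_⟩,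
    Φ, ?_, continuous_induced_dom, fun m f => ?_⟩
  · exact (TestAlgebra.subst_degreeOneX _ 0).trans lacunarySeries_zero
  · have h := @Continuous.comp _ _ _ (TopologicalSpace.induced Φ.symm _) _ _ _ _
      (TestAlgebra.continuous_substAlgHom coeffBounded_lacunarySeries)
      (continuous_induced_dom (f := Φ.symm))
    convert! h using 1
    exact funext fun a => congrArg Subtype.val (Φ.apply_symm_apply a).symm
  · rw [continuous_induced_rng]
    convert! continuous_id using 1
    exact funext Φ.symm_apply_apply
  · exact congrArg (TestAlgebra.q m) (Φ.symm_apply_apply f)
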